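/- Let $k \ge 2$ be an integer and let $\mathbf{x} = (a(n))_{n\ge 0}$ be a $k$-automatic sequence over a finite alphabet $\Delta$; that is, there is a deterministic finite automaton with output which, on reading the canonical base-$k$ expansion of $n$ (most significant digit first, without leading zeros, the expansion of $0$ being the empty word), outputs $a(n)$, for every $n \ge 0$. For $n \ge 0$ let $p(n)$ be the number of distinct words $w$ of length $n$ that are palindromes ($w$ equals its reversal) and that occur in $\mathbf{x}$, i.e. $w = a(i)a(i+1)\cdots a(i+n-1)$ for some $i \ge 0$. Then the sequence $(p(n))_{n\ge 0}$ is $(\mathbb{N},k)$-regular: there exist finitely many sequences $f_1,\dots,f_r : \mathbb{N}\to\mathbb{N}$ such that $p$ is an $\mathbb{N}$-linear combination of $f_1,\dots,f_r$ and, for all $1\le i\le r$ and $0 \le c < k$, the sequence $(f_i(kn+c))_{n\ge 0}$ is an $\mathbb{N}$-linear combination of $f_1,\dots,f_r$. Moreover, $(p(n))_{n\ge 0}$ is $k$-automatic if and only if it is bounded. -/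

import Mathlib

namespace AutSeq

/-- The integer `[w]_k` represented in base `k` by the word `w = a₁ ⋯ aₘ` over the alphabet
`{0, …, k - 1}`, most significant digit first. -/
def wordVal {k : ℕ} (w : List (Fin k)) : ℕ :=
  Nat.ofDigits k (w.reverse.map (fun a : Fin k => (a : ℕ)))

/-- `w` is the canonical base-`k` expansion of an integer: it does not begin with the digit `0`.
The empty word is the canonical expansion of `0`. -/
def IsCanonical {k : ℕ} (w : List (Fin k)) : Prop :=
  ∀ a : Fin k, a ∈ w.head? → (a : ℕ) ≠ 0

/-- A deterministic automaton with output, with input alphabet `A`, states `Q` and output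
alphabet `D`. -/
structure DFAO (A Q D : Type*) where
  start : Q
  step : Q → A → Q
  out : Q → D

/-- The output associated with the last state reached on reading the word `w`. -/
def DFAO.run {A Q D : Type*} (M : DFAO A Q D) (w : List A) : D :=
  M.out (w.foldl M.step M.start)

/-- A sequence is `k`-automatic if some automaton with finitely many states, on reading the
canonical base-`k` expansion of `n`, outputs the `n`-th term. -/
def IsAutomatic {D : Type*} (k : ℕ) (x : ℕ → D) : Prop :=
  ∃ (Q : Type) (_ : Finite Q) (M : DFAO (Fin k) Q D),
    ∀ w : List (Fin k), IsCanonical w → M.run w = x (wordVal w)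

/-- A sequence `f` over a semiring `R` is `(R, k)`-regular if there are finitely many sequences
`g 0, …, g (r - 1)` such that `f` is an `R`-linear combination of them and, for all `i` and all
`0 ≤ a < k`, so is the subsequence `n ↦ g i (k n + a)`. -/
def IsRegular (R : Type*) [Semiring R] (k : ℕ) (f : ℕ → R) : Prop :=
  ∃ (r : ℕ) (g : Fin r → ℕ → R),
    f ∈ Submodule.span R (Set.range g) ∧
    ∀ (i : Fin r) (a : ℕ), a < k →
      (fun n => g i (k * n + a)) ∈ Submodule.span R (Set.range g)

/-- The factor `x(i) x(i+1) ⋯ x(i+n-1)` of length `n` of `x` beginning at position `i`. -/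
def factor {D : Type*} (x : ℕ → D) (i n : ℕ) : List D :=
  List.ofFn (fun t : Fin n => x (i + t))

/-- The set of palindromic factors of length `n` of `x`. -/
def palFactors {D : Type*} (x : ℕ → D) (n : ℕ) : Set (List D) :=
  {w | (∃ i, w = factor x i n) ∧ w.reverse = w}

theorem palFactors_finite {D : Type*} [Finite D] (x : ℕ → D) (n : ℕ) :
    (palFactors x n).Finite := by
  refine (List.finite_length_eq D n).subset ?_
  rintro w ⟨⟨i, rfl⟩, -⟩
  simp [factor]

/-- The number of distinct palindromic factors of length `n` of `x`. -/
noncomputable def palComplexity {D : Type*} (x : ℕ → D) (n : ℕ) : ℕ :=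
  (palFactors x n).ncard

end AutSeq

/-!
A sequence is `k`-automatic exactly when its `k`-kernel is finite, and the same finiteness condition
makes sense for maps on `ℕ ^ m`, where all coordinates are read digit by digit simultaneously. Maps
with finite kernel are closed under Boolean operations and under quantification over `ℕ`, and they
include the solution sets of linear inequalities as well as the composites of an automatic sequence
with linear maps. So the relation between `i` and `n` saying that the factor of length `n` at
position `i` is a palindrome and does not occur earlier has finite kernel. The number of such `i` is
the palindrome complexity at `n`, and splitting these `i` according to their last digit expresses
its `k`-kernel in terms of the finitely many counting functions of the kernel elements.

A bounded sequence in the `ℕ`-span of finitely many sequences needs only bounded coefficients, so a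
bounded `(ℕ, k)`-regular sequence has a finite `k`-kernel.
-/

namespace AutSeq

variable {k : ℕ}

/-- The map `n ↦ k n + a`, which appends the digit `a` to the base-`k` expansion of `n`. -/
def appendDigit (k : ℕ) (a : Fin k) (n : ℕ) : ℕ :=
  k * n + a

/-- The coordinatewise version of `appendDigit`: one digit is appended to each `e i`. -/
def appendDigits {ι : Type*} (k : ℕ) (a : ι → Fin k) (e : ι → ℕ) : ι → ℕ :=
  fun i => appendDigit k (a i) (e i)

theorem appendDigit_inj {a b : Fin k} {m n : ℕ} :
    appendDigit k a m = appendDigit k b n ↔ a = b ∧ m = n := by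
  refine ⟨fun h => ?_, fun ⟨ha, hm⟩ => by rw [ha, hm]⟩
  have hmod : (a : ℕ) = b := by
    simpa only [appendDigit, Nat.mul_add_mod, Nat.mod_eq_of_lt, Fin.is_lt] using
      congrArg (· % k) h
  have hdiv : m = n := by
    simpa only [appendDigit, Nat.mul_add_div a.pos, Nat.div_eq_of_lt, Fin.is_lt, add_zero] using
      congrArg (· / k) h
  exact ⟨Fin.ext hmod, hdiv⟩

theorem appendDigit_injective (a : Fin k) : Function.Injective (appendDigit k a) :=
  fun _ _ h => (appendDigit_inj.mp h).2

theorem appendDigit_mod_div (hk : 0 < k) (n : ℕ) :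
    appendDigit k ⟨n % k, Nat.mod_lt n hk⟩ (n / k) = n :=
  Nat.div_add_mod n k

theorem exists_iff_exists_appendDigit (hk : 0 < k) {p : ℕ → Prop} :
    (∃ n, p n) ↔ ∃ a n, p (appendDigit k a n) :=
  ⟨fun ⟨n, hn⟩ => ⟨_, _, (appendDigit_mod_div hk n).symm ▸ hn⟩, fun ⟨_, _, h⟩ => ⟨_, h⟩⟩

theorem appendDigits_cons {m : ℕ} (b : Fin k) (a : Fin m → Fin k) (y : ℕ) (e : Fin m → ℕ) :
    appendDigits k (Fin.cons b a : Fin (m + 1) → Fin k) (Fin.cons y e) =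
      Fin.cons (appendDigit k b y) (appendDigits k a e) := by
  ext i
  cases i using Fin.cases <;> rfl

section Kernel

/-- `f` lies in a finite set of maps that is closed under precomposition with each `s a`. For
`s = appendDigit k` this says that the `k`-kernel of the sequence `f`, the set of all subsequences
`n ↦ f (k ^ j * n + c)` with `c < k ^ j`, is finite; for `s = appendDigits k` it is the analogous
condition on maps of several variables. A relation is treated as a map to `Prop`. -/
def HasFiniteKernel {A E D : Type*} (s : A → E → E) (f : E → D) : Prop :=
  ∃ K : Set (E → D), K.Finite ∧ f ∈ K ∧ ∀ h ∈ K, ∀ a, h ∘ s a ∈ K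

variable {A E D D₁ D₂ : Type*} {s : A → E → E}

theorem hasFiniteKernel_of_step [Finite D] {f : E → D} (δ : D → A → D)
    (hf : ∀ a e, f (s a e) = δ (f e) a) : HasFiniteKernel s f := by
  refine ⟨Set.range fun φ : D → D => φ ∘ f, Set.finite_range _, ⟨id, rfl⟩, ?_⟩
  rintro _ ⟨φ, rfl⟩ a
  exact ⟨fun q => φ (δ q a), funext fun e => congrArg φ (hf a e).symm⟩

theorem HasFiniteKernel.map {f : E → D} (hf : HasFiniteKernel s f) (φ : D → D₁) :
    HasFiniteKernel s fun e => φ (f e) := by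
  obtain ⟨K, hK, hfK, hstep⟩ := hf
  refine ⟨(φ ∘ ·) '' K, hK.image _, ⟨f, hfK, rfl⟩, ?_⟩
  rintro _ ⟨h, hh, rfl⟩ a
  exact ⟨_, hstep h hh a, rfl⟩

theorem HasFiniteKernel.map₂ {f : E → D} {g : E → D₁} (hf : HasFiniteKernel s f)
    (φ : D → D₁ → D₂) (hg : HasFiniteKernel s g) : HasFiniteKernel s fun e => φ (f e) (g e) := by
  obtain ⟨K, hK, hfK, hKstep⟩ := hf
  obtain ⟨L, hL, hgL, hLstep⟩ := hg
  refine ⟨Set.image2 (fun h h' e => φ (h e) (h' e)) K L, hK.image2 _ hL, ⟨f, hfK, g, hgL, rfl⟩, ?_⟩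
  rintro _ ⟨h, hh, h', hh', rfl⟩ a
  exact ⟨_, hKstep h hh a, _, hLstep h' hh' a, rfl⟩

theorem HasFiniteKernel.exists {m : ℕ} (hk : 0 < k) {R : (Fin m → ℕ) → ℕ → Prop}
    (hR : HasFiniteKernel (appendDigits k) fun e : Fin (m + 1) → ℕ => R (Fin.tail e) (e 0)) :
    HasFiniteKernel (appendDigits k) fun e => ∃ y, R e y := by
  obtain ⟨K, hK, hRK, hstep⟩ := hR
  -- Splitting off the last digit of `y` turns one relation into `k` of them, so the kernel consists
  -- of projections of finite unions.
  refine ⟨(fun T e => ∃ h ∈ T, ∃ y, h (Fin.cons y e)) '' 𝒫 K, hK.finite_subsets.image _,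
    ⟨{_}, Set.singleton_subset_iff.mpr hRK, by simp⟩, ?_⟩
  rintro _ ⟨T, hT, rfl⟩ a
  refine ⟨Set.image2 (fun h b => h ∘ appendDigits k (Fin.cons b a : Fin (m + 1) → Fin k)) T
    Set.univ, ?_, ?_⟩
  · rintro _ ⟨h, hh, b, -, rfl⟩
    exact hstep h (hT hh) _
  · ext e
    simp only [Set.exists_mem_image2, Set.mem_univ, true_and, Function.comp_apply,
      appendDigits_cons]
    exact exists_congr fun h => and_congr_right fun _ =>
      (exists_iff_exists_appendDigit hk (p := fun y => h (Fin.cons y _))).symm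

theorem HasFiniteKernel.forall {m : ℕ} (hk : 0 < k) {R : (Fin m → ℕ) → ℕ → Prop}
    (hR : HasFiniteKernel (appendDigits k) fun e : Fin (m + 1) → ℕ => R (Fin.tail e) (e 0)) :
    HasFiniteKernel (appendDigits k) fun e => ∀ y, R e y := by
  simpa only [not_exists, not_not] using! ((hR.map Not).exists hk (R := fun e y => ¬ R e y)).map Not

theorem HasFiniteKernel.comp_linear [Finite A] (hk : 1 < k) {x : ℕ → D}
    (hx : HasFiniteKernel (appendDigit k) x) {L : E → ℕ} {δ : A → ℕ}
    (hL : ∀ a e, L (s a e) = k * L e + δ a) : HasFiniteKernel s fun e => x (L e) := by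
  obtain ⟨K, hK, hxK, hstep⟩ := hx
  obtain ⟨C, hC⟩ := (Set.finite_range δ).bddAbove
  -- The carry stays at most `C`, because `(C + δ a) / k ≤ C`.
  refine ⟨Set.image2 (fun h c e => h (L e + c)) K (Set.Iic C), hK.image2 _ (Set.finite_Iic C),
    ⟨x, hxK, 0, Nat.zero_le C, rfl⟩, ?_⟩
  rintro _ ⟨h, hh, c, hc, rfl⟩ a
  have hk0 : 0 < k := by omega
  have hδ : δ a ≤ C := hC ⟨a, rfl⟩
  have hcarry : (δ a + c) / k ≤ C :=
    Nat.div_le_of_le_mul ((add_le_add hδ hc).trans (by nlinarith))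
  refine ⟨_, hstep h hh ⟨(δ a + c) % k, Nat.mod_lt _ hk0⟩, (δ a + c) / k, hcarry,
    funext fun e => ?_⟩
  have hdigit : appendDigit k ⟨(δ a + c) % k, Nat.mod_lt _ hk0⟩ (L e + (δ a + c) / k) =
      L (s a e) + c := by
    rw [appendDigit, hL, mul_add, add_assoc, Nat.div_add_mod, add_assoc]
  exact congrArg h hdigit

theorem hasFiniteKernel_le [Finite A] (hk : 1 < k) {L : E → ℤ} {δ : A → ℤ}
    (hL : ∀ a e, L (s a e) = k * L e + δ a) (d : ℤ) : HasFiniteKernel s fun e => L e ≤ d := by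
  obtain ⟨C, hC⟩ := ((Set.finite_range δ).image abs).bddAbove
  have hδ (a : A) : |δ a| ≤ max C |d| := (hC ⟨_, ⟨a, rfl⟩, rfl⟩).trans (le_max_left _ _)
  refine ⟨(fun c e => L e ≤ c) '' {c : ℤ | |c| ≤ max C |d|}, Set.Finite.image _ ?_,
    ⟨d, le_max_right C |d|, rfl⟩, ?_⟩
  · simp only [abs_le]
    exact Set.finite_Icc _ _
  rintro _ ⟨c, hc, rfl⟩ a
  have hk0 : (0 : ℤ) < k := by omega
  refine ⟨(c - δ a) / k, ?_, funext fun e => propext ?_⟩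
  · have hδa := abs_le.mp (hδ a)
    have hca := abs_le.mp (Set.mem_ofPred.mp hc)
    refine abs_le.mpr ⟨(Int.le_ediv_iff_mul_le hk0).mpr ?_, Int.ediv_le_of_le_mul hk0 ?_⟩ <;>
      nlinarith
  · simp only [Function.comp_apply, hL, Int.le_ediv_iff_mul_le hk0, mul_comm (L e),
      le_sub_iff_add_le]

theorem hasFiniteKernel_eq [Finite A] (hk : 1 < k) {L : E → ℤ} {δ : A → ℤ}
    (hL : ∀ a e, L (s a e) = k * L e + δ a) (d : ℤ) : HasFiniteKernel s fun e => L e = d := by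
  have h := (hasFiniteKernel_le hk hL d).map₂ And ((hasFiniteKernel_le hk hL (d - 1)).map Not)
  convert! h using 3
  omega

variable {ι : Type*} [Finite ι]

theorem hasFiniteKernel_lt (hk : 1 < k) (p q : ι) :
    HasFiniteKernel (appendDigits k) fun e => e p < e q := by
  have h := hasFiniteKernel_le (s := appendDigits k) (L := fun e => (e p : ℤ) - e q)
    (δ := fun a => ((a p : ℕ) - (a q : ℕ) : ℤ)) hk
    (fun a e => by simp only [appendDigits, appendDigit]; push_cast; ring) (-1)
  convert! h using 3
  omega

theorem hasFiniteKernel_add_add_one_eq (hk : 1 < k) (p q r : ι) :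
    HasFiniteKernel (appendDigits k) fun e => e p + e q + 1 = e r := by
  have h := hasFiniteKernel_eq (s := appendDigits k) (L := fun e => (e p : ℤ) + e q - e r)
    (δ := fun a => ((a p : ℕ) + (a q : ℕ) - (a r : ℕ) : ℤ)) hk
    (fun a e => by simp only [appendDigits, appendDigit]; push_cast; ring) (-1)
  convert! h using 3
  omega

theorem HasFiniteKernel.comp_add (hk : 1 < k) {x : ℕ → D}
    (hx : HasFiniteKernel (appendDigit k) x) (p q : ι) :
    HasFiniteKernel (appendDigits k) fun e => x (e p + e q) :=
  hx.comp_linear (δ := fun a => a p + a q) hk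
    fun a e => by simp only [appendDigits, appendDigit]; ring

end Kernel

section Automatic

variable {D : Type*} {x : ℕ → D}

theorem wordVal_append_singleton (w : List (Fin k)) (a : Fin k) :
    wordVal (w ++ [a]) = appendDigit k a (wordVal w) := by
  simp [wordVal, appendDigit, Nat.ofDigits_cons, add_comm]

/-- The canonical base-`k` expansion of `n`, most significant digit first. -/
def expansion (hk : 1 < k) (n : ℕ) : List (Fin k) :=
  ((Nat.digits k n).pmap Fin.mk fun _ hd => Nat.digits_lt_base hk hd).reverse

theorem map_val_expansion (hk : 1 < k) (n : ℕ) :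
    (expansion hk n).map Fin.val = (Nat.digits k n).reverse := by
  simp [expansion, List.map_pmap]

theorem wordVal_expansion (hk : 1 < k) (n : ℕ) : wordVal (expansion hk n) = n := by
  rw [wordVal, List.map_reverse, map_val_expansion, List.reverse_reverse, Nat.ofDigits_digits]

theorem isCanonical_expansion (hk : 1 < k) (n : ℕ) : IsCanonical (expansion hk n) := by
  intro a ha
  have hlast : (Nat.digits k n).getLast? = some (a : ℕ) := by
    rw [← List.head?_reverse, ← map_val_expansion hk, List.head?_map, Option.mem_def.mp ha]
    rfl
  obtain ⟨hne, hlast⟩ := List.mem_getLast?_eq_getLast hlast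
  rw [hlast]
  exact Nat.getLast_digit_ne_zero k (Nat.digits_ne_nil_iff_ne_zero.mp hne)

theorem expansion_appendDigit (hk : 1 < k) {a : Fin k} {n : ℕ} (h : appendDigit k a n ≠ 0) :
    expansion hk (appendDigit k a n) = expansion hk n ++ [a] := by
  have hdigits : Nat.digits k (appendDigit k a n) = (a : ℕ) :: Nat.digits k n := by
    rw [appendDigit, add_comm]
    refine Nat.digits_add k hk a n a.isLt ?_
    by_contra! hzero
    simp [appendDigit, hzero] at h
  simp [expansion, hdigits]

theorem IsAutomatic.exists_eq_run_expansion (hk : 1 < k) (hx : IsAutomatic k x) :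
    ∃ (Q : Type) (_ : Finite Q) (M : DFAO (Fin k) Q D), ∀ n, x n = M.run (expansion hk n) := by
  obtain ⟨Q, hQ, M, hM⟩ := hx
  refine ⟨Q, hQ, M, fun n => ?_⟩
  rw [hM _ (isCanonical_expansion hk n), wordVal_expansion]

theorem IsAutomatic.finite_range (hk : 1 < k) (hx : IsAutomatic k x) : (Set.range x).Finite := by
  obtain ⟨Q, _, M, hM⟩ := hx.exists_eq_run_expansion hk
  refine (Set.finite_range M.out).subset ?_
  rintro _ ⟨n, rfl⟩
  exact ⟨_, (hM n).symm⟩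

theorem IsAutomatic.hasFiniteKernel (hk : 1 < k) (hx : IsAutomatic k x) :
    HasFiniteKernel (appendDigit k) x := by
  obtain ⟨Q, _, M, hM⟩ := hx.exists_eq_run_expansion hk
  -- A digit `0` read at the very beginning may change the state of `M`, so the new state also
  -- records whether `n = 0`.
  let state (n : ℕ) : Q × Bool := ((expansion hk n).foldl M.step M.start, n = 0)
  have hstep (a : Fin k) (n : ℕ) : state (appendDigit k a n) =
      if n = 0 ∧ (a : ℕ) = 0 then state n else (M.step (state n).1 a, false) := by
    have hzero : appendDigit k a n = 0 ↔ n = 0 ∧ (a : ℕ) = 0 := by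
      simp [appendDigit, a.pos.ne']
    split_ifs with h
    · rw [hzero.mpr h, h.1]
    · have hne := mt hzero.mp h
      simp [state, expansion_appendDigit hk hne, hne]
  have hstate : HasFiniteKernel (appendDigit k) state :=
    hasFiniteKernel_of_step (fun q a => if q.2 ∧ (a : ℕ) = 0 then q else (M.step q.1 a, false))
      (by simpa [state] using hstep)
  rw [funext hM]
  exact hstate.map fun q => M.out q.1

theorem HasFiniteKernel.isAutomatic (hx : HasFiniteKernel (appendDigit k) x) :
    IsAutomatic k x := by
  obtain ⟨K, hK, hxK, hstep⟩ := hx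
  obtain ⟨r, g, -, rfl⟩ := hK.fin_param
  obtain ⟨i₀, rfl⟩ := hxK
  choose next hnext using fun i a => hstep (g i) ⟨i, rfl⟩ a
  let M : DFAO (Fin k) (Fin r → Fin r) D :=
    { start := id
      step := fun T a i => T (next i a)
      out := fun T => g (T i₀) 0 }
  have hread (w : List (Fin k)) (i : Fin r) : g (w.foldl M.step M.start i) 0 = g i (wordVal w) := by
    induction w using List.reverseRecOn generalizing i with
    | nil => rfl
    | append_singleton w a ih =>
      rw [List.foldl_concat, wordVal_append_singleton, ← Function.comp_apply (f := g i), ← hnext]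
      exact ih (next i a)
  exact ⟨Fin r → Fin r, inferInstance, M, fun w _ => hread w i₀⟩

end Automatic

section Regular

theorem isRegular_of_finite {R : Type*} [Semiring R] {f : ℕ → R} {G : Set (ℕ → R)}
    (hG : G.Finite) (hf : f ∈ Submodule.span R G)
    (hstep : ∀ g ∈ G, ∀ a, g ∘ appendDigit k a ∈ Submodule.span R G) : IsRegular R k f := by
  obtain ⟨r, g, -, rfl⟩ := hG.fin_param
  exact ⟨r, g, hf, fun i a ha => hstep (g i) ⟨i, rfl⟩ ⟨a, ha⟩⟩

theorem finite_setOf_mem_span_le {ι α : Type*} [Finite ι] (g : ι → α → ℕ) (B : ℕ) :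
    {h | h ∈ Submodule.span ℕ (Set.range g) ∧ ∀ n, h n ≤ B}.Finite := by
  cases nonempty_fintype ι
  refine (Set.finite_range fun c : ι → Fin (B + 1) => ∑ i, (c i : ℕ) • g i).subset ?_
  rintro _ ⟨hspan, hle⟩
  obtain ⟨c, rfl⟩ := (Submodule.mem_span_range_iff_exists_fun ℕ).mp hspan
  refine ⟨fun i => ⟨min (c i) B, by omega⟩, Finset.sum_congr rfl fun i _ => funext fun n => ?_⟩
  rcases Nat.eq_zero_or_pos (g i n) with hzero | hpos
  · simp [hzero]
  · have hc : c i ≤ B := calc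
      c i ≤ c i * g i n := Nat.le_mul_of_pos_right _ hpos
      _ ≤ ∑ j, c j * g j n :=
        Finset.single_le_sum (f := fun j => c j * g j n) (fun _ _ => Nat.zero_le _)
          (Finset.mem_univ i)
      _ ≤ B := by simpa using hle n
    simp [min_eq_left hc]

theorem IsRegular.hasFiniteKernel_of_bddAbove {f : ℕ → ℕ} (hf : IsRegular ℕ k f)
    (hb : BddAbove (Set.range f)) : HasFiniteKernel (appendDigit k) f := by
  obtain ⟨r, g, hfg, hg⟩ := hf
  obtain ⟨B, hB⟩ := hb
  refine ⟨_, finite_setOf_mem_span_le g B, ⟨hfg, fun n => hB ⟨n, rfl⟩⟩, fun h hh a =>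
    ⟨?_, fun n => hh.2 _⟩⟩
  have hle : Submodule.span ℕ (Set.range g) ≤
      (Submodule.span ℕ (Set.range g)).comap (LinearMap.funLeft ℕ ℕ (appendDigit k a)) := by
    rw [Submodule.span_le]
    rintro _ ⟨i, rfl⟩
    exact hg i a a.isLt
  exact hle hh.1

theorem IsRegular.isAutomatic_iff_bddAbove (hk : 1 < k) {f : ℕ → ℕ} (hf : IsRegular ℕ k f) :
    IsAutomatic k f ↔ BddAbove (Set.range f) :=
  ⟨fun h => (h.finite_range hk).bddAbove, fun h => (hf.hasFiniteKernel_of_bddAbove h).isAutomatic⟩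

theorem ncard_eq_sum_ncard_preimage_appendDigit (hk : 0 < k) {S : Set ℕ} (hS : S.Finite) :
    S.ncard = ∑ a, (appendDigit k a ⁻¹' S).ncard := by
  have hunion : S = ⋃ a, appendDigit k a '' (appendDigit k a ⁻¹' S) := by
    ext i
    rw [Set.mem_iUnion]
    refine ⟨fun hi => ⟨_, i / k, ?_, appendDigit_mod_div hk i⟩, ?_⟩
    · rwa [Set.mem_preimage, appendDigit_mod_div hk]
    · rintro ⟨a, j, hj, rfl⟩
      exact hj
  have hdisjoint : Pairwise
      (Function.onFun Disjoint fun a => appendDigit k a '' (appendDigit k a ⁻¹' S)) := by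
    intro a b hab
    rw [Function.onFun, Set.disjoint_left]
    rintro _ ⟨i, -, rfl⟩ ⟨j, -, hij⟩
    exact hab (appendDigit_inj.mp hij).1.symm
  calc S.ncard = ∑ a, (appendDigit k a '' (appendDigit k a ⁻¹' S)).ncard := by
        conv_lhs => rw [hunion]
        rw [Set.ncard_iUnion_of_finite (fun a => hS.subset (Set.image_preimage_subset _ _))
          hdisjoint, finsum_eq_sum_of_fintype]
    _ = ∑ a, (appendDigit k a ⁻¹' S).ncard :=
        Finset.sum_congr rfl fun a _ => Set.ncard_image_of_injective _ (appendDigit_injective a)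

theorem HasFiniteKernel.isRegular_ncard (hk : 0 < k) {R : ℕ → ℕ → Prop}
    (hR : HasFiniteKernel (appendDigits k) fun e : Fin 2 → ℕ => R (e 0) (e 1))
    (hfin : ∀ n, {i | R i n}.Finite) : IsRegular ℕ k fun n => {i | R i n}.ncard := by
  obtain ⟨K, hK, hRK, hstep⟩ := hR
  have happend (a b : Fin k) (i n : ℕ) :
      appendDigits k ![a, b] ![i, n] = ![appendDigit k a i, appendDigit k b n] := by
    ext j
    fin_cases j <;> rfl
  let count (h : (Fin 2 → ℕ) → Prop) (n : ℕ) : ℕ := {i | h ![i, n]}.ncard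
  let K' := {h ∈ K | ∀ n, {i | h ![i, n]}.Finite}
  refine isRegular_of_finite (G := count '' K') ((hK.subset fun _ h => h.1).image _)
    (Submodule.subset_span ⟨_, ⟨hRK, hfin⟩, rfl⟩) ?_
  rintro _ ⟨h, ⟨hhK, hhfin⟩, rfl⟩ b
  have hmem (a : Fin k) : h ∘ appendDigits k ![a, b] ∈ K' := by
    refine ⟨hstep h hhK _, fun n => ?_⟩
    simpa only [Function.comp_apply, happend] using!
      (hhfin (appendDigit k b n)).preimage (appendDigit_injective a).injOn
  have hcount : count h ∘ appendDigit k b = ∑ a, count (h ∘ appendDigits k ![a, b]) := by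
    ext n
    simp only [Function.comp_apply, Finset.sum_apply, count, happend]
    exact ncard_eq_sum_ncard_preimage_appendDigit hk (hhfin _)
  rw [hcount]
  exact Submodule.sum_mem _ fun a _ => Submodule.subset_span ⟨_, hmem a, rfl⟩

end Regular

section Factors

variable {D : Type*} {x : ℕ → D}

/-- The factor of length `n` of `x` beginning at position `i` does not occur at any earlier
position. Counting first occurrences amounts to counting distinct factors. -/
def IsFirstOccurrence (x : ℕ → D) (i n : ℕ) : Prop :=
  ∀ j < i, factor x j n ≠ factor x i n

theorem bijOn_factor_isFirstOccurrence (x : ℕ → D) (P : List D → Prop) (n : ℕ) :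
    Set.BijOn (fun i => factor x i n) {i | IsFirstOccurrence x i n ∧ P (factor x i n)}
      {w | (∃ i, w = factor x i n) ∧ P w} := by
  classical
  refine ⟨fun i hi => ⟨⟨i, rfl⟩, hi.2⟩, fun i hi j hj hij => ?_, ?_⟩
  · exact le_antisymm (not_lt.mp fun h => hi.1 j h hij.symm) (not_lt.mp fun h => hj.1 i h hij)
  · rintro w ⟨hw, hP⟩
    have hfirst := Nat.find_spec hw
    refine ⟨Nat.find hw, ⟨fun j hj hji => Nat.find_min hw hj ?_, hfirst ▸ hP⟩, hfirst.symm⟩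
    rw [hji, ← hfirst]

theorem finite_setOf_eq_factor (hx : (Set.range x).Finite) (n : ℕ) :
    {w | ∃ i, w = factor x i n}.Finite := by
  have : Finite (Set.range x) := hx
  refine (Set.finite_range fun v : Fin n → Set.range x => List.ofFn fun t => (v t : D)).subset ?_
  rintro _ ⟨i, rfl⟩
  exact ⟨fun t => ⟨x (i + t), i + t, rfl⟩, rfl⟩

theorem factor_eq_factor_iff {i j n : ℕ} :
    factor x i n = factor x j n ↔ ∀ t < n, x (i + t) = x (j + t) := by
  rw [factor, factor, List.ofFn_inj, funext_iff, Fin.forall_iff]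

theorem reverse_factor_eq_iff {i n : ℕ} :
    (factor x i n).reverse = factor x i n ↔ ∀ s t, s + t + 1 = n → x (i + s) = x (i + t) := by
  have hreverse : (factor x i n).reverse = List.ofFn fun t : Fin n => x (i + t.rev) := by
    refine List.ext_getElem (by simp [factor]) fun t _ _ => ?_
    simp [factor, Nat.sub_sub, Nat.add_comm]
  rw [hreverse, factor, List.ofFn_inj, funext_iff]
  refine ⟨fun h s t hst => ?_, fun h t => h _ _ (by rw [Fin.val_rev]; omega)⟩
  have ht := h ⟨t, by omega⟩
  rwa [Fin.val_rev, show n - (t + 1) = s by omega] at ht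

theorem HasFiniteKernel.factor_eq_factor {m : ℕ} (hk : 1 < k)
    (hx : HasFiniteKernel (appendDigit k) x) (p q r : Fin m) :
    HasFiniteKernel (appendDigits k) fun e => factor x (e p) (e r) = factor x (e q) (e r) := by
  simp only [factor_eq_factor_iff]
  exact .forall (by omega) ((hasFiniteKernel_lt hk 0 r.succ).map₂ (· → ·)
    ((hx.comp_add hk p.succ 0).map₂ Eq (hx.comp_add hk q.succ 0)))

theorem HasFiniteKernel.isFirstOccurrence {m : ℕ} (hk : 1 < k)
    (hx : HasFiniteKernel (appendDigit k) x) (p q : Fin m) :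
    HasFiniteKernel (appendDigits k) fun e => IsFirstOccurrence x (e p) (e q) :=
  .forall (by omega) ((hasFiniteKernel_lt hk 0 p.succ).map₂ (· → ·)
    ((hx.factor_eq_factor hk 0 p.succ q.succ).map Not))

theorem HasFiniteKernel.reverse_factor_eq {m : ℕ} (hk : 1 < k)
    (hx : HasFiniteKernel (appendDigit k) x) (p q : Fin m) :
    HasFiniteKernel (appendDigits k)
      fun e => (factor x (e p) (e q)).reverse = factor x (e p) (e q) := by
  simp only [reverse_factor_eq_iff]
  exact .forall (by omega) (.forall (by omega)
    ((hasFiniteKernel_add_add_one_eq hk 1 0 q.succ.succ).map₂ (· → ·)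
      ((hx.comp_add hk p.succ.succ 1).map₂ Eq (hx.comp_add hk p.succ.succ 0))))

theorem IsAutomatic.isRegular_ncard_factors (hk : 1 < k) (hx : IsAutomatic k x)
    {P : List D → Prop}
    (hP : HasFiniteKernel (appendDigits k) fun e : Fin 2 → ℕ => P (factor x (e 0) (e 1))) :
    IsRegular ℕ k fun n => {w | (∃ i, w = factor x i n) ∧ P w}.ncard := by
  have hbij := bijOn_factor_isFirstOccurrence x P
  have hfin (n : ℕ) : {i | IsFirstOccurrence x i n ∧ P (factor x i n)}.Finite :=
    (hbij n).finite_iff_finite.mpr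
      ((finite_setOf_eq_factor (hx.finite_range hk) n).subset fun _ h => h.1)
  have hcount := HasFiniteKernel.isRegular_ncard (by omega)
    (R := fun i n => IsFirstOccurrence x i n ∧ P (factor x i n))
    (((hx.hasFiniteKernel hk).isFirstOccurrence hk 0 1).map₂ And hP) hfin
  simpa only [← (hbij _).image_eq, (hbij _).injOn.ncard_image] using! hcount

theorem IsAutomatic.isRegular_palComplexity (hk : 1 < k) (hx : IsAutomatic k x) :
    IsRegular ℕ k (palComplexity x) :=
  hx.isRegular_ncard_factors hk ((hx.hasFiniteKernel hk).reverse_factor_eq hk 0 1)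

end Factors

end AutSeq

theorem mainTheorem8_general (k : ℕ) (hk : 2 ≤ k) {D : Type*} (x : ℕ → D)
    (hx : AutSeq.IsAutomatic k x) :
    AutSeq.IsRegular ℕ k (AutSeq.palComplexity x) ∧
      (AutSeq.IsAutomatic k (AutSeq.palComplexity x) ↔
        BddAbove (Set.range (AutSeq.palComplexity x))) :=
  have hreg := hx.isRegular_palComplexity hk
  ⟨hreg, hreg.isAutomatic_iff_bddAbove hk⟩

theorem mainTheorem8 (k : ℕ) (hk : 2 ≤ k) {D : Type*} [Finite D] (x : ℕ → D)
    (hx : AutSeq.IsAutomatic k x) :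
    AutSeq.IsRegular ℕ k (AutSeq.palComplexity x) ∧
      (AutSeq.IsAutomatic k (AutSeq.palComplexity x) ↔
        BddAbove (Set.range (AutSeq.palComplexity x))) :=
  mainTheorem8_general k hk x hx
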